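/- Let $\mathcal H$ be a Hermitian operator (Hamiltonian) on a Hilbert space of finite dimension at least $2$, with eigenvalues $E_0\le E_1\le\cdots$ listed with multiplicity, let $|\Psi_0\rangle$ be a unit ground state ($\mathcal H|\Psi_0\rangle=E_0|\Psi_0\rangle$), and let $\alpha\ge\|\mathcal H\|$ (operator norm). Let $|\Phi_{0,i}\rangle$ be a unit vector (initial guess) with overlap $\gamma_i=|\langle\Psi_0|\Phi_{0,i}\rangle|$, let $\gamma_f\in\mathbb R$ be the desired final overlap, and let $N_{iter}\ge 1$ be an integer. Let $\mu,\delta,\epsilon$ be real and let $S(\cdot)=S(\cdot,\epsilon,\delta)$ be a real polynomial with $|S(x)|\le 1$ on $[-1,1]$ and $|S(x)-\mathrm{sgn}(x)|\le\epsilon$ whenever $\delta\le|x|\le 1$. Let $\mathcal R_{\Psi_0}(\epsilon)$ be either of the following unitaries on an auxiliary register (with reference basis state $|0\rangle$) and the system: (A) any unitary block encoding of $S\big(\frac{\mathcal H-\mu I}{\alpha+|\mu|}\big)$ with normalization $1$ and error $0$, that is, any unitary with $(\langle 0|\otimes I)\,\mathcal R_{\Psi_0}(\epsilon)\,(|0\rangle\otimes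 I)=S\big(\frac{\mathcal H-\mu I}{\alpha+|\mu|}\big)$; (B) the quantum signal processing circuit built from a Hermitian unitary $U$ with $(\alpha+|\mu|)(\langle 0|\otimes I)U(|0\rangle\otimes I)=\mathcal H-\mu I$ and from real phases $\phi_0,\dots,\phi_d$ implementing $S$: with one additional auxiliary qubit, and $\Pi=|0\rangle\langle 0|$ on the auxiliary register of $U$, it is $e^{i\phi_0 Z\otimes(2\Pi-I)}\prod_{j=1}^d\big(U e^{i\phi_j Z\otimes(2\Pi-I)}\big)$ conjugated by a Hadamard gate on the additional qubit (which carries $Z$; its reference state is $|0\rangle$). The phases implement $S$ if for all $x\in[-1,1]$ the real part of the upper left entry of $e^{i\phi_0 Z}\prod_{j=1}^d\big(W(x)e^{i\phi_jZ}\big)$, where $W(x)=\begin{pmatrix}x&\sqrt{1-x^2}\\ \sqrt{1-x^2}&-x\end{pmatrix}$, equals $S(x)$. Let $\mathcal R_{\Phi_{0,i}}=2|0,\Phi_{0,i}\rangle\langle 0,\Phi_{0,i}|-I$ and let $$|\Phi_{0,f}\rangle=\big(\mathcal R_{\Phi_{0,i}}\,\mathcal R_{\Psi_0}(\epsilon)\big)^{N_{iter}}|0,\Phi_{0,i}\rangle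 .$$ Assume that 1. $E_0<\mu<E_1$; 2. $\delta\le\min_k|E_k-\mu|/(4\alpha)$. Let $s=|\sin((2N_{iter}+1)\arcsin\gamma_i)|$, which is the overlap with $|\Psi_0\rangle$ that $N_{iter}$ rounds of amplitude amplification with the exact reflector $I-2|\Psi_0\rangle\langle\Psi_0|$ would reach. (a) If $N_{iter}$ is such that exact amplitude amplification reaches the ground state, i.e. $s=1$, and if 3. $\epsilon\le(1-\gamma_f^2)/(6N_{iter}^2)$, then $|\langle 0,\Psi_0|\Phi_{0,f}\rangle|\ge\gamma_f$. (b) More generally, for every $N_{iter}\ge 1$, if $\epsilon\le(s^2-\gamma_f^2)/(6N_{iter}^2)$, then $|\langle 0,\Psi_0|\Phi_{0,f}\rangle|\ge\gamma_f$. -/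

import Mathlib

open Matrix Polynomial
open scoped Kronecker

/-- The eigenvalues `E 0 ≤ E 1 ≤ ⋯` of a Hermitian matrix, listed with multiplicity in increasing
order. (Mathlib's `eigenvalues₀` lists them in decreasing order.) -/
noncomputable def energy {ι : Type*} [Fintype ι] [DecidableEq ι] {H : Matrix ι ι ℂ}
    (hH : H.IsHermitian) (k : Fin (Fintype.card ι)) : ℝ :=
  hH.eigenvalues₀ k.rev

/-- The operator (spectral) norm of a matrix, i.e. its norm as an operator on the Hilbert space. -/
noncomputable def opNorm {ι : Type*} [Fintype ι] [DecidableEq ι] (A : Matrix ι ι ℂ) : ℝ :=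
  ‖Matrix.toEuclideanCLM (𝕜 := ℂ) A‖

/-- The overlap `|⟨ψ|φ⟩|`. -/
noncomputable def overlap {ι : Type*} [Fintype ι] (ψ φ : ι → ℂ) : ℝ :=
  ‖star ψ ⬝ᵥ φ‖

/-- The state `|k₀⟩ ⊗ |ψ⟩` of an auxiliary register (orthonormal basis indexed by `κ`) and the
system. For `m` auxiliary qubits, `κ` is `Fin m → Fin 2` and `k₀` is the all-zeros string. -/
def withAux {κ ι : Type*} [DecidableEq κ] (k₀ : κ) (ψ : ι → ℂ) : κ × ι → ℂ :=
  fun p => if p.1 = k₀ then ψ p.2 else 0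

/-- The block `(⟨k₀| ⊗ I) U (|k₀⟩ ⊗ I)`. -/
def auxBlock {κ ι : Type*} (k₀ : κ) (U : Matrix (κ × ι) (κ × ι) ℂ) : Matrix ι ι ℂ :=
  U.submatrix (fun i => (k₀, i)) (fun i => (k₀, i))

/-- `U` is a block encoding of `A` with normalization `β` and error `err`:
`U` is unitary and `‖A - β (⟨k₀| ⊗ I) U (|k₀⟩ ⊗ I)‖ ≤ err`. -/
def IsBlockEncoding {κ ι : Type*} [Fintype κ] [DecidableEq κ] [Fintype ι] [DecidableEq ι]
    (k₀ : κ) (β err : ℝ) (A : Matrix ι ι ℂ) (U : Matrix (κ × ι) (κ × ι) ℂ) : Prop :=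
  U ∈ Matrix.unitaryGroup (κ × ι) ℂ ∧ opNorm (A - (β : ℂ) • auxBlock k₀ U) ≤ err

/-- `S` is a real polynomial approximation `S(·, ε, δ)` of the sign function: it is bounded by `1`
on `[-1, 1]` and `ε`-close to the sign function on `[-1, -δ] ∪ [δ, 1]`. -/
def IsSignApprox (S : ℝ[X]) (ε δ : ℝ) : Prop :=
  (∀ x : ℝ, |x| ≤ 1 → |S.eval x| ≤ 1) ∧
    ∀ x : ℝ, δ ≤ |x| → |x| ≤ 1 → |S.eval x - Real.sign x| ≤ ε

/-- The matrix function `S((H - μ I) / (α + |μ|))`. -/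
noncomputable def filteredHamiltonian {ι : Type*} [Fintype ι] [DecidableEq ι]
    (S : ℝ[X]) (H : Matrix ι ι ℂ) (μ α : ℝ) : Matrix ι ι ℂ :=
  Polynomial.aeval ((((α + |μ|)⁻¹ : ℝ) : ℂ) • (H - (μ : ℂ) • (1 : Matrix ι ι ℂ))) S

/-- The reflector `2 |v⟩⟨v| - I` about a unit vector `v`. -/
def reflectorAbout {ι : Type*} [DecidableEq ι] (v : ι → ℂ) : Matrix ι ι ℂ :=
  (2 : ℂ) • Matrix.vecMulVec v (star v) - 1

/-- The output `(R_Φ R)^N |k₀⟩|Φ⟩` of `N` rounds of amplitude amplification that use `R`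
as the reflector about the target. -/
def amplified {κ ι : Type*} [Fintype κ] [DecidableEq κ] [Fintype ι] [DecidableEq ι]
    (k₀ : κ) (Φ : ι → ℂ) (R : Matrix (κ × ι) (κ × ι) ℂ) (N : ℕ) : κ × ι → ℂ :=
  ((reflectorAbout (withAux k₀ Φ) * R) ^ N) *ᵥ withAux k₀ Φ

/-- The single-qubit quantum signal processing product
`e^{i φ₀ Z} ∏_j (W(x) e^{i φ_j Z})`, where `W(x)` is the two-dimensional action of a Hermitian
block encoding on an eigenvector whose (rescaled) eigenvalue is `x`. -/
noncomputable def qspMatrix (φ₀ : ℝ) (φs : List ℝ) (x : ℝ) : Matrix (Fin 2) (Fin 2) ℂ :=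
  let rot : ℝ → Matrix (Fin 2) (Fin 2) ℂ := fun φ =>
    !![Complex.exp (Complex.I * φ), 0; 0, Complex.exp (-(Complex.I * φ))]
  let W : Matrix (Fin 2) (Fin 2) ℂ :=
    !![(x : ℂ), (Real.sqrt (1 - x ^ 2) : ℂ); (Real.sqrt (1 - x ^ 2) : ℂ), -(x : ℂ)]
  rot φ₀ * (φs.map fun φ => W * rot φ).prod

/-- The phases implement the real polynomial `S`: on `[-1, 1]`, the real part of the upper left
entry of the signal processing product is `S`. -/
def PhasesImplement (φ₀ : ℝ) (φs : List ℝ) (S : ℝ[X]) : Prop :=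
  ∀ x : ℝ, |x| ≤ 1 → (qspMatrix φ₀ φs x 0 0).re = S.eval x

/-- The controlled phase rotation `e^{i φ Z ⊗ (2Π - I)}`, where `Z` acts on one additional
auxiliary qubit and `Π = |k₀⟩⟨k₀|` on the auxiliary register of the block encoding. -/
noncomputable def phaseGate {κ : Type*} [DecidableEq κ] (ι : Type*) [DecidableEq ι]
    (k₀ : κ) (φ : ℝ) : Matrix ((Fin 2 × κ) × ι) ((Fin 2 × κ) × ι) ℂ :=
  Matrix.diagonal fun p =>
    Complex.exp (Complex.I * φ * (if p.1.1 = 0 then 1 else -1) *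
      (if p.1.2 = k₀ then 1 else -1))

/-- The Hadamard gate on the additional auxiliary qubit. -/
noncomputable def hadamardGate (κ ι : Type*) [DecidableEq κ] [DecidableEq ι] :
    Matrix ((Fin 2 × κ) × ι) ((Fin 2 × κ) × ι) ℂ :=
  ((((Real.sqrt 2)⁻¹ : ℝ) : ℂ) • !![(1 : ℂ), 1; 1, -1] ⊗ₖ (1 : Matrix κ κ ℂ)) ⊗ₖ
    (1 : Matrix ι ι ℂ)

/-- The gate `U`, acting trivially on the additional auxiliary qubit. -/
def liftGate {κ ι : Type*} (U : Matrix (κ × ι) (κ × ι) ℂ) :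
    Matrix ((Fin 2 × κ) × ι) ((Fin 2 × κ) × ι) ℂ :=
  ((1 : Matrix (Fin 2) (Fin 2) ℂ) ⊗ₖ U).submatrix
    (Equiv.prodAssoc (Fin 2) κ ι) (Equiv.prodAssoc (Fin 2) κ ι)

/-- The quantum signal processing circuit built from `U`: the alternating product
`e^{i φ₀ Z ⊗ (2Π - I)} ∏_j (U e^{i φ_j Z ⊗ (2Π - I)})`, conjugated by a Hadamard gate on the
additional auxiliary qubit, which selects the real part of the polynomial. -/
noncomputable def qspCircuit {κ ι : Type*} [Fintype κ] [DecidableEq κ] [Fintype ι] [DecidableEq ι]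
    (k₀ : κ) (φ₀ : ℝ) (φs : List ℝ) (U : Matrix (κ × ι) (κ × ι) ℂ) :
    Matrix ((Fin 2 × κ) × ι) ((Fin 2 × κ) × ι) ℂ :=
  hadamardGate κ ι *
    (phaseGate ι k₀ φ₀ * (φs.map fun φ => liftGate U * phaseGate ι k₀ φ).prod) *
    hadamardGate κ ι

/-! Since `E₀ < μ < E₁`, the ground state is simple and `I - 2|Ψ₀⟩⟨Ψ₀|` is the sign of `H - μ`. The
rescaled spectrum lies where `S` is `ε`-close to the sign, so the filtered Hamiltonian is `ε`-close
to the exact reflector (`norm_filteredHamiltonian_sub_reflector_le`). In both realizations, `R` is a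
unitary with this block; for the signal processing circuit this is `auxBlock_qspCircuit_mulVec`.

The crux is `norm_inner_amplification_sub_le`. A unitary whose compression is `ε`-close to a unitary
leaks up to `√(2ε)` out of the subspace per application, so accumulating vector errors would only
give order `N√ε`. The final amplitude, however, is tested against a state inside the subspace:
leaked weight must also come back, which costs another `√(2ε)`. Summing over rounds gives an
amplitude error of at most `N²ε`.

`norm_inner_exact_amplification` supplies the ideal amplitude `s`, and `le_of_abs_sub_le_of_le_div`
turns the amplitude error into the stated condition on squares. -/

/-! ### Amplitude amplification with an approximate reflector. -/

section Perturbation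

open scoped InnerProductSpace

variable {E K : Type*} [NormedAddCommGroup E] [InnerProductSpace ℂ E]
  [NormedAddCommGroup K] [InnerProductSpace ℂ K]

/-- If the compression of an isometric map `R` is `ε`-close to an isometric map `R₀`, then `R`
leaks at most `√(2ε)` out of the compressed subspace. -/
theorem norm_sub_le_sqrt_of_compression {J : E →ₗᵢ[ℂ] K} {R : K → K} {R₀ : E → E} {ε : ℝ}
    (hR : ∀ x, ‖R x‖ = ‖x‖) (hR₀ : ∀ x, ‖R₀ x‖ = ‖x‖)
    (h : ∀ v w : E, ‖v‖ = 1 → ‖w‖ = 1 → ‖⟪J w, R (J v)⟫_ℂ - ⟪w, R₀ v⟫_ℂ‖ ≤ ε)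
    {v : E} (hv : ‖v‖ = 1) : ‖R (J v) - J (R₀ v)‖ ≤ √(2 * ε) := by
  apply Real.le_sqrt_of_sq_le
  have h₀ : ‖R₀ v‖ = 1 := by rw [hR₀, hv]
  -- Testing against `R₀ v` gives `Re ⟪J (R₀ v), R (J v)⟫ ≥ 1 - ε`; the squared distance of the two
  -- unit vectors is then at most `2ε`.
  have h₁ := h v (R₀ v) hv h₀
  rw [inner_self_eq_norm_sq_to_K, h₀] at h₁
  have h₂ := (Complex.abs_re_le_norm _).trans h₁
  simp only [Complex.sub_re] at h₂
  have h₃ := (abs_le.mp h₂).1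
  rw [norm_sub_sq (𝕜 := ℂ), hR, J.norm_map, J.norm_map, hv, h₀, inner_re_symm]
  simp at h₃ ⊢
  linarith

theorem norm_pow_apply_of_isometric {G : K →L[ℂ] K} (hG : ∀ x, ‖G x‖ = ‖x‖) (n : ℕ) (x : K) :
    ‖(G ^ n) x‖ = ‖x‖ := by
  induction n with
  | zero => simp
  | succ n ih => rw [pow_succ', mul_apply_eq_comp, hG, ih]

/-- Errors of isometric steps accumulate linearly. -/
theorem norm_pow_sub_pow_le {J : E →ₗᵢ[ℂ] K} {G : K →L[ℂ] K} {G₀ : E →L[ℂ] E} {η : ℝ}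
    (hG : ∀ x, ‖G x‖ = ‖x‖) (hG₀ : ∀ x, ‖G₀ x‖ = ‖x‖)
    (h : ∀ v : E, ‖v‖ = 1 → ‖G (J v) - J (G₀ v)‖ ≤ η) {v : E} (hv : ‖v‖ = 1) (n : ℕ) :
    ‖(G ^ n) (J v) - J ((G₀ ^ n) v)‖ ≤ n * η := by
  induction n with
  | zero => simp
  | succ n ih =>
    have e : (G ^ (n + 1)) (J v) - J ((G₀ ^ (n + 1)) v) =
        G ((G ^ n) (J v) - J ((G₀ ^ n) v)) +
          (G (J ((G₀ ^ n) v)) - J (G₀ ((G₀ ^ n) v))) := by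
      simp only [pow_succ', mul_apply_eq_comp, map_sub]
      abel
    rw [e]
    refine (norm_add_le _ _).trans ?_
    have h₂ := h ((G₀ ^ n) v) (by rw [norm_pow_apply_of_isometric hG₀, hv])
    rw [hG, Nat.cast_succ]
    linarith

variable [CompleteSpace E] [CompleteSpace K]

/-- Amplitude amplification with a unitary `R` whose compression is `ε`-close to the reflection
`R₀`: both the leakage and the return to the compressed subspace cost `√(2ε)` per round, so the
amplitude changes by at most `n² ε` in `n` rounds. -/
theorem norm_inner_amplification_sub_le {J : E →ₗᵢ[ℂ] K} {F R : K →L[ℂ] K}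
    {F₀ R₀ : E →L[ℂ] E} {ε : ℝ} (hF : F ∈ unitary (K →L[ℂ] K)) (hR : R ∈ unitary (K →L[ℂ] K))
    (hF₀ : F₀ ∈ unitary (E →L[ℂ] E)) (hR₀ : R₀ ∈ unitary (E →L[ℂ] E))
    (sF : star F = F) (sR₀ : star R₀ = R₀)
    (hFJ : ∀ v, F (J v) = J (F₀ v)) (hε : 0 ≤ ε)
    (h : ∀ v w : E, ‖v‖ = 1 → ‖w‖ = 1 → ‖⟪J w, R (J v)⟫_ℂ - ⟪w, R₀ v⟫_ℂ‖ ≤ ε)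
    {ψ : E} (hψ : ‖ψ‖ = 1) (n : ℕ) {φ : E} (hφ : ‖φ‖ = 1) :
    ‖⟪J ψ, ((F * R) ^ n) (J φ)⟫_ℂ - ⟪ψ, ((F₀ * R₀) ^ n) φ⟫_ℂ‖ ≤ (n : ℝ) ^ 2 * ε := by
  have iF := fun x => ContinuousLinearMap.norm_map_of_mem_unitary hF x
  have iR := fun x => ContinuousLinearMap.norm_map_of_mem_unitary hR x
  have iF₀ := fun x => ContinuousLinearMap.norm_map_of_mem_unitary hF₀ x
  have iR₀ := fun x => ContinuousLinearMap.norm_map_of_mem_unitary hR₀ x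
  have iR' := fun x => ContinuousLinearMap.norm_map_of_mem_unitary (Unitary.star_mem hR) x
  have fwd : ∀ v : E, ‖v‖ = 1 → ‖R (J v) - J (R₀ v)‖ ≤ √(2 * ε) := fun v hv =>
    norm_sub_le_sqrt_of_compression iR iR₀ h hv
  -- Since `R₀` is self-adjoint, the compression of `star R` is `ε`-close to the same `R₀`.
  have bwd : ∀ v : E, ‖v‖ = 1 → ‖star R (J v) - J (R₀ v)‖ ≤ √(2 * ε) := fun v hv => by
    refine norm_sub_le_sqrt_of_compression iR' iR₀ (fun v w hv hw => ?_) hv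
    rw [ContinuousLinearMap.star_eq_adjoint, ContinuousLinearMap.adjoint_inner_right]
    have h₁ := h w v hw hv
    rw [← ContinuousLinearMap.adjoint_inner_left R₀, ← ContinuousLinearMap.star_eq_adjoint, sR₀,
      ← inner_conj_symm, ← inner_conj_symm (R₀ v), ← map_sub, RCLike.norm_conj] at h₁
    exact h₁
  have sq : √(2 * ε) * √(2 * ε) = 2 * ε := Real.mul_self_sqrt (by positivity)
  induction n generalizing φ with
  | zero => simp
  | succ n ih =>
    have hφ' : ‖F₀ (R₀ φ)‖ = 1 := by rw [iF₀, iR₀, hφ]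
    -- Split off the first round: `w` is its deviation from the exact step. The remaining `n` rounds
    -- are moved onto the target by taking adjoints: `hh` is the target evolved backwards by the
    -- actual gates, `k` by the exact ones.
    set w := R (J φ) - J (R₀ φ) with hw
    set k := ((R₀ * F₀) ^ n) ψ with hk
    set hh := ((star R * F) ^ n) (J ψ) with hhh
    have hk1 : ‖k‖ = 1 := by
      rw [hk, norm_pow_apply_of_isometric (fun x => by
        rw [mul_apply_eq_comp, iR₀, iF₀]), hψ]
    have drift : ‖hh - J k‖ ≤ n * √(2 * ε) := by
      refine norm_pow_sub_pow_le (fun x => ?_) (fun x => ?_) (fun v hv => ?_) hψ n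
      · rw [mul_apply_eq_comp, iR', iF]
      · rw [mul_apply_eq_comp, iR₀, iF₀]
      · rw [mul_apply_eq_comp, mul_apply_eq_comp, hFJ]
        exact bwd _ (by rw [iF₀, hv])
    have e₁ : ((F * R) ^ (n + 1)) (J φ) =
        ((F * R) ^ n) (J (F₀ (R₀ φ))) + ((F * R) ^ n) (F w) := by
      rw [pow_succ, mul_apply_eq_comp, ← map_add, ← hFJ, ← map_add, hw,
        add_sub_cancel, mul_apply_eq_comp]
    have e₂ : ⟪J ψ, ((F * R) ^ n) (F w)⟫_ℂ = ⟪hh - J k, F w⟫_ℂ + ⟪J k, F w⟫_ℂ := by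
      rw [← inner_add_left, sub_add_cancel, ← ContinuousLinearMap.adjoint_inner_left,
        ← ContinuousLinearMap.star_eq_adjoint, star_pow, star_mul, sF]
    have e₃ : ⟪J k, F w⟫_ℂ = ⟪J (F₀ k), R (J φ)⟫_ℂ - ⟪F₀ k, R₀ φ⟫_ℂ := by
      rw [← ContinuousLinearMap.adjoint_inner_left, ← ContinuousLinearMap.star_eq_adjoint, sF,
        hFJ, hw, inner_sub_right, J.inner_map_map]
    -- Backward drift times forward leakage costs `2nε`. Against `J k` the deviation `w` is seen
    -- only through the compression, costing `ε` (`b₂`). The sum `(2n + 1)ε` is exactly `(n + 1)²ε -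
    -- n²ε`.
    have b₁ : ‖⟪hh - J k, F w⟫_ℂ‖ ≤ n * √(2 * ε) * √(2 * ε) := by
      refine (norm_inner_le_norm _ _).trans ?_
      rw [iF]
      exact mul_le_mul drift (fwd φ hφ) (norm_nonneg _) (by positivity)
    have b₂ : ‖⟪J k, F w⟫_ℂ‖ ≤ ε := by
      rw [e₃]
      exact h _ _ hφ (by rw [iF₀, hk1])
    have b₃ := ih hφ'
    have e₄ : ((F₀ * R₀) ^ (n + 1)) φ = ((F₀ * R₀) ^ n) (F₀ (R₀ φ)) := by
      rw [pow_succ, mul_apply_eq_comp, mul_apply_eq_comp]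
    rw [e₁, e₄, inner_add_right, e₂, add_sub_right_comm]
    refine (norm_add_le _ _).trans ?_
    have b₄ := norm_add_le (⟪hh - J k, F w⟫_ℂ) (⟪J k, F w⟫_ℂ)
    rw [mul_assoc, sq] at b₁
    rw [Nat.cast_succ]
    linarith

end Perturbation

/-! ### Exact amplitude amplification. -/

section Exact

open scoped InnerProductSpace

variable {E : Type*} [NormedAddCommGroup E] [InnerProductSpace ℂ E]

/-- Amplitude amplification with exact reflectors rotates by twice the angle `arcsin |⟪ψ, φ⟫|`. -/
theorem norm_inner_exact_amplification {ψ φ : E} (hψ : ‖ψ‖ = 1) (hφ : ‖φ‖ = 1)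
    {F₀ R₀ : E →L[ℂ] E} (hF₀ : ∀ v, F₀ v = (2 * ⟪φ, v⟫_ℂ) • φ - v)
    (hR₀ : ∀ v, R₀ v = v - (2 * ⟪ψ, v⟫_ℂ) • ψ) (n : ℕ) :
    ‖⟪ψ, ((F₀ * R₀) ^ n) φ⟫_ℂ‖ = |Real.sin ((2 * n + 1) * Real.arcsin ‖⟪ψ, φ⟫_ℂ‖)| := by
  set γ := ‖⟪ψ, φ⟫_ℂ‖ with hγ
  have hγ1 : γ ≤ 1 := by
    simpa [hψ, hφ] using norm_inner_le_norm (𝕜 := ℂ) ψ φ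
  set θ := Real.arcsin γ with hθ
  have hs : Real.sin θ = γ := Real.sin_arcsin (by linarith [norm_nonneg ⟪ψ, φ⟫_ℂ]) hγ1
  -- The phase of the overlap; it stays a common factor of every target amplitude.
  obtain ⟨u, hu, hcu⟩ : ∃ u : ℂ, ‖u‖ = 1 ∧ ⟪ψ, φ⟫_ℂ = γ * u := by
    by_cases h0 : ⟪ψ, φ⟫_ℂ = 0
    · exact ⟨1, by simp, by simp [hγ, h0]⟩
    · have : (γ : ℂ) ≠ 0 := by simpa [hγ] using h0
      refine ⟨⟪ψ, φ⟫_ℂ / γ, ?_, by field_simp⟩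
      rw [norm_div, Complex.norm_real, ← hγ, Real.norm_of_nonneg (norm_nonneg _), div_self]
      simpa [hγ] using h0
  have hψψ : ⟪ψ, ψ⟫_ℂ = 1 := by rw [inner_self_eq_norm_sq_to_K, hψ]; simp
  have hφφ : ⟪φ, φ⟫_ℂ = 1 := by rw [inner_self_eq_norm_sq_to_K, hφ]; simp
  have hcu' : ⟪φ, ψ⟫_ℂ = γ * (starRingEnd ℂ) u := by
    rw [← inner_conj_symm, hcu]; simp
  have huu : u * (starRingEnd ℂ) u = 1 := by
    rw [Complex.mul_conj, Complex.normSq_eq_norm_sq, hu]; simp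
  -- The overlaps with `ψ` and `φ` satisfy a closed recursion. Using `φ` rather than a normalized
  -- vector orthogonal to `ψ` avoids a separate case when `φ` is parallel to `ψ`.
  have key : ∀ n : ℕ, ⟪ψ, ((F₀ * R₀) ^ n) φ⟫_ℂ = u * (Real.sin ((2 * n + 1) * θ) : ℝ) ∧
      ⟪φ, ((F₀ * R₀) ^ n) φ⟫_ℂ = (Real.cos (2 * n * θ) : ℝ) := by
    intro n
    induction n with
    | zero => simp [hs, hcu, hφ, mul_comm]
    | succ n ih =>
      obtain ⟨h₁, h₂⟩ := ih
      set g := ((F₀ * R₀) ^ n) φ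
      have eg : ((F₀ * R₀) ^ (n + 1)) φ = F₀ (R₀ g) := by
        rw [pow_succ', mul_apply_eq_comp, mul_apply_eq_comp]
      set A := (2 * n + 1) * θ with hA
      have a₁ : 2 * (n : ℝ) * θ = A - θ := by rw [hA]; ring
      have a₂ : (2 * ((n + 1 : ℕ) : ℝ) + 1) * θ = A + 2 * θ := by rw [hA]; push_cast; ring
      have a₃ : 2 * ((n + 1 : ℕ) : ℝ) * θ = A + θ := by rw [hA]; push_cast; ring
      have t₁ : Real.sin (A + 2 * θ) = 2 * Real.cos (A - θ) * γ + Real.sin A * (1 - 4 * γ ^ 2) := by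
        rw [Real.sin_add, Real.cos_sub, Real.cos_two_mul, Real.sin_two_mul, ← hs]
        linear_combination (2 * Real.sin A) * Real.sin_sq_add_cos_sq θ
      have t₂ : Real.cos (A + θ) = Real.cos (A - θ) - 2 * Real.sin A * γ := by
        rw [Real.cos_add, Real.cos_sub, ← hs]
        ring
      rw [a₁] at h₂
      rw [eg, hF₀, hR₀, a₂, a₃, t₁, t₂]
      simp only [inner_sub_right, inner_smul_right, h₁, h₂, hcu, hcu', hψψ, hφφ]
      push_cast
      constructor
      · linear_combination (-4 * γ ^ 2 * u * (Complex.sin A)) * huu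
      · linear_combination (-2 * γ * (Complex.sin A)) * huu
  rw [(key n).1, norm_mul, hu, one_mul, Complex.norm_real, Real.norm_eq_abs]

end Exact

/-! ### The filtered Hamiltonian and the ground state reflector. -/

section Spectral

open scoped InnerProductSpace

variable {ι : Type*} [Fintype ι] [DecidableEq ι]

theorem toEuclideanCLM_apply_of_mulVec {A : Matrix ι ι ℂ} {v : EuclideanSpace ℂ ι} {c : ℂ}
    (h : A *ᵥ ⇑v = c • ⇑v) : toEuclideanCLM (𝕜 := ℂ) A v = c • v := by
  apply WithLp.ofLp_injective 2
  rw [ofLp_toEuclideanCLM, h, WithLp.ofLp_smul]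

/-- A matrix that is diagonal in an orthonormal basis is bounded by its largest diagonal entry. -/
theorem norm_toEuclideanCLM_apply_le (b : OrthonormalBasis ι ℂ (EuclideanSpace ℂ ι))
    {D : Matrix ι ι ℂ} {d : ι → ℂ} (hD : ∀ k, D *ᵥ ⇑(b k) = d k • ⇑(b k)) {ε : ℝ} (hε : 0 ≤ ε)
    (hd : ∀ k, ‖d k‖ ≤ ε) (v : EuclideanSpace ℂ ι) :
    ‖toEuclideanCLM (𝕜 := ℂ) D v‖ ≤ ε * ‖v‖ := by
  have hin : ∀ j, ⟪b j, toEuclideanCLM (𝕜 := ℂ) D v⟫_ℂ = d j * ⟪b j, v⟫_ℂ := by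
    intro j
    conv_lhs => rw [← b.sum_repr' v, map_sum]
    simp_rw [map_smul, toEuclideanCLM_apply_of_mulVec (hD _), inner_sum, inner_smul_right,
      b.inner_eq_ite]
    simp [mul_comm]
  rw [← pow_le_pow_iff_left₀ (norm_nonneg _) (by positivity) two_ne_zero]
  rw [mul_pow, ← b.sum_sq_norm_inner_right, ← b.sum_sq_norm_inner_right v, Finset.mul_sum]
  refine Finset.sum_le_sum fun k _ => ?_
  rw [hin, norm_mul, mul_pow]
  gcongr
  exact hd k

/-- A matrix is determined by its action on an orthonormal basis. -/
theorem eq_of_mulVec_orthonormalBasis (b : OrthonormalBasis ι ℂ (EuclideanSpace ℂ ι))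
    {A B : Matrix ι ι ℂ} (h : ∀ k, A *ᵥ ⇑(b k) = B *ᵥ ⇑(b k)) : A = B := by
  apply EquivLike.injective (toEuclideanCLM (𝕜 := ℂ) (n := ι))
  apply ContinuousLinearMap.coe_injective
  refine b.toBasis.ext fun k => ?_
  apply WithLp.ofLp_injective 2
  exact h k

theorem aeval_mulVec_of_mulVec_eq_smul {A : Matrix ι ι ℂ} {v : ι → ℂ} {x : ℝ}
    (h : A *ᵥ v = (x : ℂ) • v) (S : ℝ[X]) :
    Polynomial.aeval A S *ᵥ v = ((S.eval x : ℝ) : ℂ) • v := by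
  induction S using Polynomial.induction_on' with
  | add p q hp hq => rw [map_add, add_mulVec, hp, hq, eval_add, Complex.ofReal_add, add_smul]
  | monomial n a =>
    have hpow : ∀ n : ℕ, (A ^ n) *ᵥ v = ((x : ℂ) ^ n) • v := by
      intro n
      induction n with
      | zero => simp
      | succ n ih => rw [pow_succ, ← mulVec_mulVec, h, mulVec_smul, ih, smul_smul, pow_succ']
    rw [aeval_monomial, ← Algebra.smul_def, smul_mulVec, hpow, eval_monomial]
    push_cast
    rw [mul_smul]
    rfl

theorem filteredHamiltonian_mulVec {H : Matrix ι ι ℂ} {v : ι → ℂ} {l : ℝ}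
    (h : H *ᵥ v = (l : ℂ) • v) (S : ℝ[X]) (μ α : ℝ) :
    filteredHamiltonian S H μ α *ᵥ v = ((S.eval ((l - μ) / (α + |μ|)) : ℝ) : ℂ) • v := by
  refine aeval_mulVec_of_mulVec_eq_smul ?_ S
  rw [smul_mulVec, sub_mulVec, smul_mulVec, one_mulVec, h, ← sub_smul, smul_smul]
  congr 1
  push_cast
  ring

theorem reflectorAbout_mulVec (v w : ι → ℂ) :
    reflectorAbout v *ᵥ w = (2 * (star v ⬝ᵥ w)) • v - w := by
  rw [reflectorAbout, sub_mulVec, smul_mulVec, one_mulVec, vecMulVec_mulVec, op_smul_eq_smul,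
    smul_smul]

omit [Fintype ι] in
theorem isHermitian_reflectorAbout (v : ι → ℂ) : (reflectorAbout v).IsHermitian := by
  rw [Matrix.IsHermitian, reflectorAbout, conjTranspose_sub, conjTranspose_smul,
    conjTranspose_vecMulVec, star_star, conjTranspose_one]
  simp

theorem reflectorAbout_mem_unitaryGroup {v : ι → ℂ} (hv : star v ⬝ᵥ v = 1) :
    reflectorAbout v ∈ Matrix.unitaryGroup ι ℂ := by
  rw [mem_unitaryGroup_iff, star_eq_conjTranspose, isHermitian_reflectorAbout v, reflectorAbout,
    sub_mul, mul_sub, smul_mul_smul_comm, vecMulVec_mul_vecMulVec, hv]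
  simp only [one_smul, mul_one, one_mul]
  module

theorem energy_monotone {H : Matrix ι ι ℂ} (hH : H.IsHermitian) : Monotone (energy hH) :=
  fun _ _ h => hH.eigenvalues₀_antitone (Fin.rev_le_rev.mpr h)

/-- The order in which the eigenvector basis lists the energies. -/
theorem exists_equiv_eigenvalues_eq_energy {H : Matrix ι ι ℂ} (hH : H.IsHermitian) :
    ∃ σ : ι ≃ Fin (Fintype.card ι), ∀ k, hH.eigenvalues k = energy hH (σ k) := by
  refine ⟨(Fintype.equivOfCardEq (Fintype.card_fin _)).symm.trans Fin.revPerm, fun k => ?_⟩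
  simp [energy, Matrix.IsHermitian.eigenvalues]

theorem abs_eigenvalues_le_opNorm {H : Matrix ι ι ℂ} (hH : H.IsHermitian) (k : ι) :
    |hH.eigenvalues k| ≤ opNorm H := by
  have h₁ : toEuclideanCLM (𝕜 := ℂ) H (hH.eigenvectorBasis k) =
      (hH.eigenvalues k : ℂ) • hH.eigenvectorBasis k :=
    toEuclideanCLM_apply_of_mulVec (hH.mulVec_eigenvectorBasis k)
  have h₂ := (toEuclideanCLM (𝕜 := ℂ) H).le_opNorm (hH.eigenvectorBasis k)
  rw [h₁, norm_smul, hH.eigenvectorBasis.norm_eq_one] at h₂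
  simpa [opNorm] using h₂

/-- Below the gap there is only the ground state: the reflector `I - 2|Ψ₀⟩⟨Ψ₀|` is the sign of
`H - μ`. -/
theorem neg_reflectorAbout_ground_mulVec (hdim : 1 < Fintype.card ι)
    {H : Matrix ι ι ℂ} (hH : H.IsHermitian) {Ψ₀ : ι → ℂ} (hΨ₀ : star Ψ₀ ⬝ᵥ Ψ₀ = 1)
    (hground : H *ᵥ Ψ₀ = (energy hH ⟨0, Nat.zero_lt_of_lt hdim⟩ : ℂ) • Ψ₀) {μ : ℝ}
    (hμ₀ : energy hH ⟨0, Nat.zero_lt_of_lt hdim⟩ < μ) (hμ₁ : μ < energy hH ⟨1, hdim⟩) (k : ι) :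
    (-reflectorAbout Ψ₀) *ᵥ ⇑(hH.eigenvectorBasis k) =
      (Real.sign (hH.eigenvalues k - μ) : ℂ) • ⇑(hH.eigenvectorBasis k) := by
  obtain ⟨σ, hσ⟩ := exists_equiv_eigenvalues_eq_energy hH
  set b := hH.eigenvectorBasis with hb
  set Ψ : EuclideanSpace ℂ ι := WithLp.toLp 2 Ψ₀ with hΨ
  have hin : ∀ j, star Ψ₀ ⬝ᵥ ⇑(b j) = ⟪Ψ, b j⟫_ℂ := fun j => by
    rw [EuclideanSpace.inner_eq_star_dotProduct, dotProduct_comm]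
  have above : ∀ j, σ j ≠ ⟨0, Nat.zero_lt_of_lt hdim⟩ → energy hH ⟨1, hdim⟩ ≤ hH.eigenvalues j := by
    intro j hj
    rw [hσ]
    refine energy_monotone hH (Fin.le_def.mpr ?_)
    have : (σ j : ℕ) ≠ 0 := fun h => hj (Fin.ext h)
    simp only
    omega
  -- Eigenvectors of a Hermitian matrix for distinct eigenvalues are orthogonal.
  have horth : ∀ j, σ j ≠ ⟨0, Nat.zero_lt_of_lt hdim⟩ → ⟪Ψ, b j⟫_ℂ = 0 := by
    intro j hj
    have h₁ : star Ψ₀ ⬝ᵥ (H *ᵥ ⇑(b j)) = (hH.eigenvalues j : ℂ) * ⟪Ψ, b j⟫_ℂ := by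
      rw [hH.mulVec_eigenvectorBasis, ← hin, dotProduct_smul]
      rfl
    have h₂ : star Ψ₀ ⬝ᵥ (H *ᵥ ⇑(b j)) =
        (energy hH ⟨0, Nat.zero_lt_of_lt hdim⟩ : ℂ) * ⟪Ψ, b j⟫_ℂ := by
      have h₃ : star Ψ₀ ᵥ* H = star (H *ᵥ Ψ₀) := by rw [star_mulVec, hH]
      rw [dotProduct_mulVec, h₃, hground, star_smul, smul_dotProduct, hin]
      simp
    rw [h₁] at h₂
    have h₃ : (hH.eigenvalues j : ℂ) ≠ (energy hH ⟨0, Nat.zero_lt_of_lt hdim⟩ : ℂ) := by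
      have := above j hj
      exact_mod_cast (show hH.eigenvalues j ≠ energy hH ⟨0, Nat.zero_lt_of_lt hdim⟩ by linarith)
    by_contra h0
    exact h₃ (mul_right_cancel₀ h0 h₂)
  rw [neg_mulVec, reflectorAbout_mulVec, hin]
  by_cases hk : σ k = ⟨0, Nat.zero_lt_of_lt hdim⟩
  -- Being orthogonal to all other basis vectors, `Ψ` is a phase times `b k`; the phase cancels in
  -- the projector.
  · have hsum : ⟪b k, Ψ⟫_ℂ • b k = Ψ := by
      conv_rhs => rw [← b.sum_repr' Ψ]
      rw [Finset.sum_eq_single_of_mem k (Finset.mem_univ k)]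
      intro j _ hj
      rw [← inner_conj_symm, horth j fun h => hj (σ.injective (h.trans hk.symm))]
      simp
    have hnorm : ⟪Ψ, b k⟫_ℂ * ⟪b k, Ψ⟫_ℂ = 1 := by
      rw [← hΨ₀]
      have : star Ψ₀ ⬝ᵥ Ψ₀ = ⟪Ψ, Ψ⟫_ℂ := by
        rw [EuclideanSpace.inner_eq_star_dotProduct, dotProduct_comm]
      rw [this, mul_comm, ← inner_smul_right, hsum]
    have hsign : Real.sign (hH.eigenvalues k - μ) = -1 := by
      apply Real.sign_of_neg
      rw [hσ, hk]
      linarith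
    have hΨb : Ψ₀ = ⟪b k, Ψ⟫_ℂ • ⇑(b k) := congrArg WithLp.ofLp hsum.symm
    rw [hsign]
    nth_rw 1 [hΨb]
    rw [smul_smul, mul_assoc, hnorm]
    push_cast
    module
  · rw [horth k hk, Real.sign_of_pos (by linarith [above k hk])]
    simp

/-- The filtered Hamiltonian is `ε`-close to the reflector `I - 2|Ψ₀⟩⟨Ψ₀|`. -/
theorem norm_filteredHamiltonian_sub_reflector_le (hdim : 1 < Fintype.card ι)
    {H : Matrix ι ι ℂ} (hH : H.IsHermitian) {Ψ₀ : ι → ℂ} (hΨ₀ : star Ψ₀ ⬝ᵥ Ψ₀ = 1)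
    (hground : H *ᵥ Ψ₀ = (energy hH ⟨0, Nat.zero_lt_of_lt hdim⟩ : ℂ) • Ψ₀) {α μ δ ε : ℝ}
    (hα : opNorm H ≤ α) {S : ℝ[X]} (hS : IsSignApprox S ε δ)
    (hμ₀ : energy hH ⟨0, Nat.zero_lt_of_lt hdim⟩ < μ) (hμ₁ : μ < energy hH ⟨1, hdim⟩)
    (hδ : δ ≤ (⨅ k, |energy hH k - μ|) / (4 * α)) :
    0 < α + |μ| ∧ (∀ k, |(hH.eigenvalues k - μ) / (α + |μ|)| ≤ 1) ∧ 0 ≤ ε ∧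
      ∀ v, ‖toEuclideanCLM (𝕜 := ℂ) (filteredHamiltonian S H μ α - -reflectorAbout Ψ₀) v‖ ≤
        ε * ‖v‖ := by
  obtain ⟨σ, hσ⟩ := exists_equiv_eigenvalues_eq_energy hH
  have hE : ∀ j, |energy hH j| ≤ α := fun j => by
    have := abs_eigenvalues_le_opNorm hH (σ.symm j)
    rw [hσ, σ.apply_symm_apply] at this
    exact this.trans hα
  -- The strict gap forces positivity: `-α ≤ E₀ < E₁ ≤ α`.
  have hα0 : 0 < α := by
    have h₀ := (abs_le.mp (hE ⟨0, Nat.zero_lt_of_lt hdim⟩)).1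
    have h₁ := (abs_le.mp (hE ⟨1, hdim⟩)).2
    linarith
  have hμα : |μ| ≤ α := by
    have h₀ := (abs_le.mp (hE ⟨0, Nat.zero_lt_of_lt hdim⟩)).1
    have h₁ := (abs_le.mp (hE ⟨1, hdim⟩)).2
    exact abs_le.mpr ⟨by linarith, by linarith⟩
  have hpos : 0 < α + |μ| := by positivity
  have hx1 : ∀ k, |(hH.eigenvalues k - μ) / (α + |μ|)| ≤ 1 := fun k => by
    rw [abs_div, abs_of_pos hpos, div_le_one hpos]
    have := abs_sub (hH.eigenvalues k) μ
    have h₂ := hE (σ k)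
    rw [← hσ] at h₂
    linarith
  -- Since `|μ| ≤ α`, the normalization satisfies `α + |μ| ≤ 2α ≤ 4α`.
  have hxδ : ∀ k, δ ≤ |(hH.eigenvalues k - μ) / (α + |μ|)| := fun k => by
    have h₁ : (⨅ j, |energy hH j - μ|) ≤ |hH.eigenvalues k - μ| := by
      rw [hσ]
      exact ciInf_le ⟨0, by rintro _ ⟨j, rfl⟩; exact abs_nonneg _⟩ (σ k)
    rw [abs_div, abs_of_pos hpos]
    refine hδ.trans (div_le_div₀ (abs_nonneg _) h₁ hpos (by linarith))
  have hsgn : ∀ k, |S.eval ((hH.eigenvalues k - μ) / (α + |μ|)) -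
      Real.sign (hH.eigenvalues k - μ)| ≤ ε := fun k => by
    have h₁ := hS.2 _ (hxδ k) (hx1 k)
    have h₂ : Real.sign ((hH.eigenvalues k - μ) / (α + |μ|)) =
        Real.sign (hH.eigenvalues k - μ) := by
      rcases lt_trichotomy (hH.eigenvalues k - μ) 0 with h | h | h
      · rw [Real.sign_of_neg h, Real.sign_of_neg (div_neg_of_neg_of_pos h hpos)]
      · rw [h, zero_div]
      · rw [Real.sign_of_pos h, Real.sign_of_pos (div_pos h hpos)]
    rwa [h₂] at h₁
  -- Nonnegativity of `ε` comes for free, because it bounds an absolute value at some eigenvalue.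
  have hε : 0 ≤ ε :=
    (abs_nonneg _).trans (hsgn (σ.symm ⟨0, Nat.zero_lt_of_lt hdim⟩))
  refine ⟨hpos, hx1, hε, norm_toEuclideanCLM_apply_le hH.eigenvectorBasis
    (d := fun k => ((S.eval ((hH.eigenvalues k - μ) / (α + |μ|)) -
      Real.sign (hH.eigenvalues k - μ) : ℝ) : ℂ)) (fun k => ?_) hε fun k => ?_⟩
  · rw [sub_mulVec, neg_reflectorAbout_ground_mulVec hdim hH hΨ₀ hground hμ₀ hμ₁,
      filteredHamiltonian_mulVec (hH.mulVec_eigenvectorBasis k), ← sub_smul]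
    push_cast
    rfl
  · rw [Complex.norm_real]
    exact hsgn k

end Spectral

/-! ### Blocks with respect to the auxiliary register. -/

section Register

variable {κ ι : Type*} [Fintype κ] [DecidableEq κ] [Fintype ι]

theorem auxBlock_mulVec (k₀ : κ) (U : Matrix (κ × ι) (κ × ι) ℂ) (v : ι → ℂ) (i : ι) :
    (auxBlock k₀ U *ᵥ v) i = (U *ᵥ withAux k₀ v) (k₀, i) := by
  simp [mulVec, dotProduct, auxBlock, withAux, Fintype.sum_prod_type]

theorem star_withAux_dotProduct (k₀ : κ) (v : ι → ℂ) (y : κ × ι → ℂ) :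
    star (withAux k₀ v) ⬝ᵥ y = star v ⬝ᵥ fun i => y (k₀, i) := by
  simp [dotProduct, withAux, Fintype.sum_prod_type, apply_ite (star : ℂ → ℂ)]

theorem star_withAux_dotProduct_withAux (k₀ : κ) (v w : ι → ℂ) :
    star (withAux k₀ v) ⬝ᵥ withAux k₀ w = star v ⬝ᵥ w := by
  rw [star_withAux_dotProduct]
  simp [withAux]

theorem auxBlock_eq_of_isBlockEncoding [DecidableEq ι] {k₀ : κ} {β : ℝ} {A : Matrix ι ι ℂ}
    {U : Matrix (κ × ι) (κ × ι) ℂ} (h : IsBlockEncoding k₀ β 0 A U) :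
    (β : ℂ) • auxBlock k₀ U = A := by
  have h₁ : opNorm (A - (β : ℂ) • auxBlock k₀ U) = 0 := le_antisymm h.2 (norm_nonneg _)
  rw [opNorm, norm_eq_zero,
    map_eq_zero_iff _ (EquivLike.injective (toEuclideanCLM (𝕜 := ℂ) (n := ι)))] at h₁
  exact (sub_eq_zero.mp h₁).symm

end Register

/-! ### Quantum signal processing by reduction to a single qubit. -/

section SignalProcessing

/-- The single-qubit rotation `e^{iφZ}`. -/
noncomputable def zRotation (φ : ℝ) : Matrix (Fin 2) (Fin 2) ℂ :=
  !![Complex.exp (Complex.I * φ), 0; 0, Complex.exp (-(Complex.I * φ))]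

/-- The signal operator `W(x)`. -/
noncomputable def signalW (x : ℝ) : Matrix (Fin 2) (Fin 2) ℂ :=
  !![(x : ℂ), (Real.sqrt (1 - x ^ 2) : ℂ); (Real.sqrt (1 - x ^ 2) : ℂ), -(x : ℂ)]

theorem qspMatrix_eq (φ₀ : ℝ) (φs : List ℝ) (x : ℝ) :
    qspMatrix φ₀ φs x = zRotation φ₀ * (φs.map fun φ => signalW x * zRotation φ).prod := rfl

theorem map_conj_zRotation (φ : ℝ) : (zRotation φ).map (starRingEnd ℂ) = zRotation (-φ) := by
  ext i j
  fin_cases i <;> fin_cases j <;> simp [zRotation, ← Complex.exp_conj]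

theorem map_conj_signalW (x : ℝ) : (signalW x).map (starRingEnd ℂ) = signalW x := by
  ext i j
  fin_cases i <;> fin_cases j <;> simp [signalW]

/-- Negating all phases conjugates the signal processing matrix. -/
theorem qspMatrix_neg (φ₀ : ℝ) (φs : List ℝ) (x : ℝ) :
    qspMatrix (-φ₀) (φs.map fun φ => -φ) x = (qspMatrix φ₀ φs x).map (starRingEnd ℂ) := by
  rw [qspMatrix_eq, qspMatrix_eq, Matrix.map_mul, map_conj_zRotation]
  congr 1
  induction φs with
  | nil => simp
  | cons φ φs ih =>
    rw [List.map_cons, List.map_cons, List.map_cons, List.prod_cons, List.prod_cons,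
      Matrix.map_mul, ih, Matrix.map_mul, map_conj_zRotation, map_conj_signalW]

variable {κ ι : Type*} [DecidableEq κ]

/-- The sign with which the additional qubit in state `q` enters the phases. -/
def zSign (q : Fin 2) : ℝ := if q = 0 then 1 else -1

/-- The columns of `T`, with the additional qubit in state `q`. -/
def withQubit (q : Fin 2) (T : Matrix (κ × ι) (Fin 2) ℂ) :
    Matrix ((Fin 2 × κ) × ι) (Fin 2) ℂ :=
  Matrix.of fun p j => if p.1.1 = q then T (p.1.2, p.2) j else 0

omit [DecidableEq κ] in
theorem withQubit_mul (q : Fin 2) (T : Matrix (κ × ι) (Fin 2) ℂ) (M : Matrix (Fin 2) (Fin 2) ℂ) :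
    withQubit q T * M = withQubit q (T * M) := by
  ext p j
  by_cases h : p.1.1 = q <;> simp [withQubit, Matrix.mul_apply, h]

variable [Fintype κ] [Fintype ι]

omit [DecidableEq κ] in
theorem liftGate_mul_withQubit (U : Matrix (κ × ι) (κ × ι) ℂ) (q : Fin 2)
    (T : Matrix (κ × ι) (Fin 2) ℂ) : liftGate U * withQubit q T = withQubit q (U * T) := by
  ext p j
  obtain ⟨⟨a, k⟩, i⟩ := p
  by_cases h : a = q <;>
    simp [withQubit, liftGate, Matrix.mul_apply, Fintype.sum_prod_type, Matrix.one_apply, h]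

/-- Column `0` of `T` lies in the range of `Π` and column `1` in its kernel, so `2Π - I` acts on the
columns as `Z`; the additional qubit contributes only the sign of the phase. -/
theorem phaseGate_mul_withQubit [DecidableEq ι] (k₀ : κ) (φ : ℝ) (q : Fin 2)
    {T : Matrix (κ × ι) (Fin 2) ℂ} (h₀ : ∀ k i, k ≠ k₀ → T (k, i) 0 = 0)
    (h₁ : ∀ i, T (k₀, i) 1 = 0) :
    phaseGate ι k₀ φ * withQubit q T = withQubit q (T * zRotation (zSign q * φ)) := by
  ext p j
  obtain ⟨⟨a, k⟩, i⟩ := p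
  rw [phaseGate, diagonal_mul]
  by_cases h : a = q
  · subst h
    by_cases hk : k = k₀
    · subst hk
      fin_cases a <;> fin_cases j <;>
        simp [withQubit, Matrix.mul_apply, zRotation, zSign, h₁, mul_comm]
    · fin_cases a <;> fin_cases j <;>
        simp [withQubit, Matrix.mul_apply, zRotation, zSign, h₀ k i hk, hk, mul_comm]
  · simp [withQubit, h]

/-- The circuit intertwines with the single-qubit signal processing matrix. -/
theorem qspProduct_mul_withQubit [DecidableEq ι] (k₀ : κ) (φ₀ : ℝ) (φs : List ℝ) (q : Fin 2)
    {U : Matrix (κ × ι) (κ × ι) ℂ} {x : ℝ} {T : Matrix (κ × ι) (Fin 2) ℂ}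
    (hT : U * T = T * signalW x) (h₀ : ∀ k i, k ≠ k₀ → T (k, i) 0 = 0)
    (h₁ : ∀ i, T (k₀, i) 1 = 0) :
    (phaseGate ι k₀ φ₀ * (φs.map fun φ => liftGate U * phaseGate ι k₀ φ).prod) * withQubit q T =
      withQubit q (T * qspMatrix (zSign q * φ₀) (φs.map fun φ => zSign q * φ) x) := by
  have step : (φs.map fun φ => liftGate U * phaseGate ι k₀ φ).prod * withQubit q T =
      withQubit q T * ((φs.map fun φ => zSign q * φ).map fun φ =>
        signalW x * zRotation φ).prod := by
    induction φs with
    | nil => simp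
    | cons φ φs ih =>
      rw [List.map_cons, List.map_cons, List.map_cons, List.prod_cons, List.prod_cons,
        Matrix.mul_assoc, ih, ← Matrix.mul_assoc, Matrix.mul_assoc (liftGate U),
        phaseGate_mul_withQubit k₀ φ q h₀ h₁, liftGate_mul_withQubit, ← Matrix.mul_assoc U, hT,
        Matrix.mul_assoc T, ← withQubit_mul, Matrix.mul_assoc]
  rw [Matrix.mul_assoc, step, ← Matrix.mul_assoc, phaseGate_mul_withQubit k₀ φ₀ q h₀ h₁,
    withQubit_mul, Matrix.mul_assoc, qspMatrix_eq]

variable [DecidableEq ι]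

theorem hadamardGate_mulVec (y : (Fin 2 × κ) × ι → ℂ) (k : κ) (i : ι) :
    (hadamardGate κ ι *ᵥ y) ((0, k), i) =
      (((Real.sqrt 2)⁻¹ : ℝ) : ℂ) * (y ((0, k), i) + y ((1, k), i)) := by
  simp [hadamardGate, mulVec, dotProduct, Fintype.sum_prod_type, Matrix.one_apply,
    Finset.sum_ite_eq, mul_add]

theorem hadamardGate_mulVec_withAux (k₀ : κ) (v : ι → ℂ) {T : Matrix (κ × ι) (Fin 2) ℂ}
    (hT : ∀ p, T p 0 = withAux k₀ v p) :
    hadamardGate κ ι *ᵥ withAux (0, k₀) v = (((Real.sqrt 2)⁻¹ : ℝ) : ℂ) •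
      (withQubit 0 T *ᵥ Pi.single 0 1 + withQubit 1 T *ᵥ Pi.single 0 1) := by
  ext p
  obtain ⟨⟨a, k⟩, i⟩ := p
  fin_cases a <;>
    simp [hadamardGate, mulVec, dotProduct, Fintype.sum_prod_type, Matrix.one_apply, withQubit, hT,
      withAux]

open scoped ComplexOrder in
/-- On an eigenvector of the encoded matrix with eigenvalue `x`, a Hermitian block encoding acts
as the signal operator `W(x)`. -/
theorem exists_mul_eq_mul_signalW {k₀ : κ} {U : Matrix (κ × ι) (κ × ι) ℂ} (hU : U.IsHermitian)
    (hU' : U ∈ Matrix.unitaryGroup (κ × ι) ℂ) {v : ι → ℂ} {x : ℝ} (hx : |x| ≤ 1)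
    (hv : auxBlock k₀ U *ᵥ v = (x : ℂ) • v) :
    ∃ T : Matrix (κ × ι) (Fin 2) ℂ, U * T = T * signalW x ∧ (∀ p, T p 0 = withAux k₀ v p) ∧
      ∀ i, T (k₀, i) 1 = 0 := by
  have hUU : U * U = 1 := by
    have := mem_unitaryGroup_iff.mp hU'
    rwa [star_eq_conjTranspose, hU] at this
  set a := withAux k₀ v with ha
  -- The part of `U a` outside the reference state. As `U² = 1`, the span of `a` and `c` is
  -- invariant, and `U` acts there as `W(x)` once `c` is rescaled by `s`.
  set c := U *ᵥ a - (x : ℂ) • a with hc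
  set s := Real.sqrt (1 - x ^ 2) with hs
  have hs2 : (s : ℂ) * s = 1 - (x : ℂ) ^ 2 := by
    have := Real.mul_self_sqrt (show 0 ≤ 1 - x ^ 2 by
      nlinarith [(abs_le.mp hx).1, (abs_le.mp hx).2])
    exact_mod_cast this
  have hUa : U *ᵥ a = c + (x : ℂ) • a := by rw [hc, sub_add_cancel]
  have hUc : U *ᵥ c = (1 - (x : ℂ) ^ 2) • a - (x : ℂ) • c := by
    rw [hc, mulVec_sub, mulVec_mulVec, hUU, one_mulVec, mulVec_smul, hUa]
    module
  have hck : ∀ i, c (k₀, i) = 0 := fun i => by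
    rw [hc, Pi.sub_apply, ha, ← auxBlock_mulVec, hv]
    simp [withAux]
  have hac : star a ⬝ᵥ c = 0 := by
    rw [ha, star_withAux_dotProduct]
    simp [hck]
  clear_value c
  have hcc : star c ⬝ᵥ c = (1 - (x : ℂ) ^ 2) * (star a ⬝ᵥ a) := by
    have h₁ : star c ⬝ᵥ a = 0 := by
      rw [star_dotProduct, hac, star_zero]
    have h₂ : star c ⬝ᵥ (U *ᵥ a) = star (U *ᵥ c) ⬝ᵥ a := by
      rw [dotProduct_mulVec, star_mulVec, hU]
    rw [hUa, hUc, dotProduct_add, dotProduct_smul, h₁, star_sub, sub_dotProduct, star_smul,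
      star_smul, smul_dotProduct, smul_dotProduct, h₁] at h₂
    simpa using h₂
  -- At `|x| = 1` one has `s = 0`, and `hcc` forces `c = 0`; with `0⁻¹ = 0` the second column is
  -- then zero and the intertwining still holds.
  have hsc : (s : ℂ) • ((s : ℂ)⁻¹ • c) = c := by
    by_cases h : (s : ℂ) = 0
    · have : c = 0 := by
        rw [← hs2, h, zero_mul, zero_mul] at hcc
        exact dotProduct_star_self_eq_zero.mp hcc
      rw [this]
      simp
    · rw [smul_smul, mul_inv_cancel₀ h, one_smul]
  have hUb : U *ᵥ ((s : ℂ)⁻¹ • c) = (s : ℂ) • a - (x : ℂ) • ((s : ℂ)⁻¹ • c) := by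
    rw [mulVec_smul, hUc, smul_sub, smul_smul, ← hs2, smul_comm (x : ℂ)]
    congr 2
    by_cases h : (s : ℂ) = 0
    · simp [h]
    · field_simp
  refine ⟨Matrix.of fun p j => ![a p, (s : ℂ)⁻¹ * c p] j, ?_, fun p => rfl, fun i => by
    simp [hck]⟩
  ext p j
  fin_cases j
  · have h₁ := congrFun hUa p
    have h₂ := congrFun hsc p
    simp [Matrix.mul_apply, signalW, Fin.sum_univ_two, mulVec, dotProduct] at h₁ h₂ ⊢
    rw [h₁, ← hs]
    linear_combination -h₂
  · have h₁ := congrFun hUb p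
    simp only [mulVec, dotProduct, Pi.smul_apply, Pi.sub_apply, smul_eq_mul] at h₁
    simp [Matrix.mul_apply, signalW, Fin.sum_univ_two]
    rw [h₁, ← hs]
    ring

/-- The signal processing circuit encodes the polynomial that its phases implement. -/
theorem auxBlock_qspCircuit_mulVec {k₀ : κ} {U : Matrix (κ × ι) (κ × ι) ℂ} (hU : U.IsHermitian)
    (hU' : U ∈ Matrix.unitaryGroup (κ × ι) ℂ) {v : ι → ℂ} {x : ℝ} (hx : |x| ≤ 1)
    (hv : auxBlock k₀ U *ᵥ v = (x : ℂ) • v) {φ₀ : ℝ} {φs : List ℝ} {S : ℝ[X]}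
    (hφ : PhasesImplement φ₀ φs S) :
    auxBlock (0, k₀) (qspCircuit k₀ φ₀ φs U) *ᵥ v = ((S.eval x : ℝ) : ℂ) • v := by
  obtain ⟨T, hT, h₀, h₁⟩ := exists_mul_eq_mul_signalW hU hU' hx hv
  have h₀' : ∀ k i, k ≠ k₀ → T (k, i) 0 = 0 := fun k i hk => by rw [h₀]; simp [withAux, hk]
  ext i
  rw [auxBlock_mulVec, qspCircuit, ← mulVec_mulVec, hadamardGate_mulVec_withAux k₀ v h₀,
    ← mulVec_mulVec, hadamardGate_mulVec, mulVec_smul, mulVec_add, mulVec_mulVec, mulVec_mulVec,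
    qspProduct_mul_withQubit k₀ φ₀ φs 0 hT h₀' h₁, qspProduct_mul_withQubit k₀ φ₀ φs 1 hT h₀' h₁]
  have z0 : zSign 0 = 1 := rfl
  have z1 : zSign 1 = -1 := rfl
  have e0 : (φs.map fun φ => zSign 0 * φ) = φs := by simp [z0]
  have e1 : (φs.map fun φ => zSign 1 * φ) = φs.map fun φ => -φ := by simp [z1]
  -- The branch with the additional qubit in state `1` sees negated phases, hence the conjugate
  -- matrix; the Hadamard gates average both branches into the real part.
  rw [e0, e1, z0, z1, one_mul, neg_one_mul, qspMatrix_neg, ← hφ x hx]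
  set M := qspMatrix φ₀ φs x
  have hre : ((M 0 0).re : ℂ) = (M 0 0 + (starRingEnd ℂ) (M 0 0)) / 2 := by
    rw [Complex.add_conj]; push_cast; ring
  have hsq : (((Real.sqrt 2)⁻¹ : ℝ) : ℂ) * (((Real.sqrt 2)⁻¹ : ℝ) : ℂ) = 1 / 2 := by
    rw [← Complex.ofReal_mul, ← mul_inv, Real.mul_self_sqrt (by norm_num)]
    push_cast
    ring
  have hTk : T (k₀, i) 0 = v i := by rw [h₀]; simp [withAux]
  simp only [mulVec_single_one, Pi.smul_apply, Pi.add_apply, col_apply, withQubit, of_apply,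
    Matrix.mul_apply, Fin.sum_univ_two, h₁, hTk, smul_eq_mul, map_apply]
  rw [hre]
  simp only [zero_mul, add_zero, ↓reduceIte, zero_ne_one, one_ne_zero, zero_add]
  linear_combination (v i * (M 0 0 + (starRingEnd ℂ) (M 0 0))) * hsq

theorem phaseGate_mem_unitaryGroup (k₀ : κ) (φ : ℝ) :
    phaseGate ι k₀ φ ∈ Matrix.unitaryGroup ((Fin 2 × κ) × ι) ℂ := by
  rw [mem_unitaryGroup_iff, star_eq_conjTranspose, phaseGate, diagonal_conjTranspose,
    diagonal_mul_diagonal, ← diagonal_one]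
  congr 1
  ext p
  rw [Pi.star_apply, ← starRingEnd_apply, ← Complex.exp_conj, ← Complex.exp_add,
    Complex.exp_eq_one_iff]
  refine ⟨0, ?_⟩
  split_ifs <;> simp

theorem liftGate_mem_unitaryGroup {U : Matrix (κ × ι) (κ × ι) ℂ}
    (hU : U ∈ Matrix.unitaryGroup (κ × ι) ℂ) :
    liftGate U ∈ Matrix.unitaryGroup ((Fin 2 × κ) × ι) ℂ := by
  have h : ((1 : Matrix (Fin 2) (Fin 2) ℂ) ⊗ₖ U) * star ((1 : Matrix (Fin 2) (Fin 2) ℂ) ⊗ₖ U) = 1 :=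
    Unitary.mul_star_self_of_mem (kronecker_mem_unitary (one_mem _) hU)
  rw [mem_unitaryGroup_iff, star_eq_conjTranspose, liftGate, conjTranspose_submatrix,
    submatrix_mul_equiv, ← star_eq_conjTranspose, h, submatrix_one_equiv]

theorem hadamardGate_mem_unitaryGroup :
    hadamardGate κ ι ∈ Matrix.unitaryGroup ((Fin 2 × κ) × ι) ℂ := by
  have hsq : (((Real.sqrt 2)⁻¹ : ℝ) : ℂ) * (((Real.sqrt 2)⁻¹ : ℝ) : ℂ) = 1 / 2 := by
    rw [← Complex.ofReal_mul, ← mul_inv, Real.mul_self_sqrt (by norm_num)]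
    push_cast
    ring
  rw [hadamardGate, ← smul_kronecker]
  refine kronecker_mem_unitary (kronecker_mem_unitary ?_ (one_mem _)) (one_mem _)
  refine mem_unitaryGroup_iff.mpr ?_
  ext i j
  fin_cases i <;> fin_cases j <;>
    simp [Matrix.mul_apply, Fin.sum_univ_two, star_eq_conjTranspose] <;>
    simp at hsq <;> linear_combination 2 * hsq

theorem qspCircuit_mem_unitaryGroup (k₀ : κ) (φ₀ : ℝ) (φs : List ℝ)
    {U : Matrix (κ × ι) (κ × ι) ℂ} (hU : U ∈ Matrix.unitaryGroup (κ × ι) ℂ) :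
    qspCircuit k₀ φ₀ φs U ∈ Matrix.unitaryGroup ((Fin 2 × κ) × ι) ℂ := by
  refine mul_mem (mul_mem hadamardGate_mem_unitaryGroup
    (mul_mem (phaseGate_mem_unitaryGroup k₀ φ₀) (list_prod_mem fun M hM => ?_)))
    hadamardGate_mem_unitaryGroup
  obtain ⟨φ, -, rfl⟩ := List.mem_map.mp hM
  exact mul_mem (liftGate_mem_unitaryGroup hU) (phaseGate_mem_unitaryGroup k₀ φ)

end SignalProcessing

/-! ### From the error bound to the final overlap. -/

section Main

open scoped InnerProductSpace

variable {κ ι : Type*} [Fintype κ] [DecidableEq κ] [Fintype ι] [DecidableEq ι]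

/-- The isometry `|ψ⟩ ↦ |k₀⟩|ψ⟩`. -/
noncomputable def auxIsometry (ι : Type*) [Fintype ι] (k₀ : κ) :
    EuclideanSpace ℂ ι →ₗᵢ[ℂ] EuclideanSpace ℂ (κ × ι) where
  toFun v := WithLp.toLp 2 (withAux k₀ ⇑v)
  map_add' v w := by
    ext p
    by_cases h : p.1 = k₀ <;> simp [withAux, h]
  map_smul' c v := by
    ext p
    by_cases h : p.1 = k₀ <;> simp [withAux, h]
  norm_map' v := by
    simp only [LinearMap.coe_mk, AddHom.coe_mk]
    rw [← sq_eq_sq₀ (norm_nonneg _) (norm_nonneg _), ← Complex.ofReal_inj]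
    push_cast
    have h₁ := inner_self_eq_norm_sq_to_K (𝕜 := ℂ) (WithLp.toLp 2 (withAux k₀ ⇑v))
    have h₂ := inner_self_eq_norm_sq_to_K (𝕜 := ℂ) v
    refine h₁.symm.trans (Eq.trans ?_ h₂)
    rw [EuclideanSpace.inner_eq_star_dotProduct, EuclideanSpace.inner_eq_star_dotProduct,
      dotProduct_comm, dotProduct_comm (v.ofLp)]
    exact star_withAux_dotProduct_withAux k₀ _ _

omit [DecidableEq ι] in
theorem ofLp_auxIsometry (k₀ : κ) (v : EuclideanSpace ℂ ι) :
    ⇑(auxIsometry ι k₀ v) = withAux k₀ ⇑v := rfl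

/-- Identifies the auxiliary block with the compression used in the abstract perturbation bound. -/
theorem inner_auxIsometry_toEuclideanCLM (k₀ : κ) (R : Matrix (κ × ι) (κ × ι) ℂ)
    (v w : EuclideanSpace ℂ ι) :
    ⟪auxIsometry ι k₀ w, toEuclideanCLM (𝕜 := ℂ) R (auxIsometry ι k₀ v)⟫_ℂ =
      ⟪w, toEuclideanCLM (𝕜 := ℂ) (auxBlock k₀ R) v⟫_ℂ := by
  rw [EuclideanSpace.inner_eq_star_dotProduct, EuclideanSpace.inner_eq_star_dotProduct,
    dotProduct_comm, ofLp_auxIsometry, star_withAux_dotProduct, dotProduct_comm]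
  congr 1
  ext i
  rw [ofLp_toEuclideanCLM, ofLp_toEuclideanCLM, auxBlock_mulVec]
  rfl

omit [DecidableEq ι] in
theorem norm_toLp_eq_one {v : ι → ℂ} (hv : star v ⬝ᵥ v = 1) : ‖WithLp.toLp 2 v‖ = 1 := by
  have h := inner_self_eq_norm_sq_to_K (𝕜 := ℂ) (WithLp.toLp 2 v)
  rw [EuclideanSpace.inner_toLp_toLp, dotProduct_comm, hv] at h
  have h' : (1 : ℝ) = ‖WithLp.toLp 2 v‖ ^ 2 := Complex.ofReal_injective (by
    push_cast
    exact h)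
  exact (pow_eq_one_iff_of_nonneg (norm_nonneg _) two_ne_zero).mp h'.symm

omit [DecidableEq ι] in
theorem overlap_eq_norm_inner (v w : ι → ℂ) :
    overlap v w = ‖⟪WithLp.toLp 2 v, WithLp.toLp 2 w⟫_ℂ‖ := by
  rw [overlap, EuclideanSpace.inner_toLp_toLp, dotProduct_comm]

theorem toEuclideanCLM_mem_unitary {A : Matrix ι ι ℂ} (hA : A ∈ Matrix.unitaryGroup ι ℂ) :
    toEuclideanCLM (𝕜 := ℂ) A ∈ unitary (EuclideanSpace ℂ ι →L[ℂ] EuclideanSpace ℂ ι) :=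
  Unitary.map_mem (toEuclideanCLM (𝕜 := ℂ) (n := ι)) hA

theorem star_toEuclideanCLM {A : Matrix ι ι ℂ} (hA : A.IsHermitian) :
    star (toEuclideanCLM (𝕜 := ℂ) A) = toEuclideanCLM (𝕜 := ℂ) A := by
  rw [← map_star, star_eq_conjTranspose, hA]

/-- Amplitude amplification with a unitary whose block is `ε`-close to the reflector
`I - 2|Ψ₀⟩⟨Ψ₀|` differs from exact amplitude amplification by at most `N² ε`. -/
theorem abs_sin_sub_overlap_amplified_le {Ψ₀ Φ : ι → ℂ} (hΨ₀ : star Ψ₀ ⬝ᵥ Ψ₀ = 1)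
    (hΦ : star Φ ⬝ᵥ Φ = 1) {ε : ℝ} (hε : 0 ≤ ε) {k₀ : κ} {R : Matrix (κ × ι) (κ × ι) ℂ}
    (hR : R ∈ Matrix.unitaryGroup (κ × ι) ℂ)
    (hB : ∀ v, ‖toEuclideanCLM (𝕜 := ℂ) (auxBlock k₀ R - -reflectorAbout Ψ₀) v‖ ≤ ε * ‖v‖)
    (N : ℕ) :
    |Real.sin ((2 * N + 1) * Real.arcsin (overlap Ψ₀ Φ))| -
      overlap (withAux k₀ Ψ₀) (amplified k₀ Φ R N) ≤ (N : ℝ) ^ 2 * ε := by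
  have hΨ := norm_toLp_eq_one hΨ₀
  have hΦ' := norm_toLp_eq_one hΦ
  set ψ : EuclideanSpace ℂ ι := WithLp.toLp 2 Ψ₀
  set φ : EuclideanSpace ℂ ι := WithLp.toLp 2 Φ
  set J := auxIsometry ι k₀
  have hHerm : (-reflectorAbout Ψ₀).IsHermitian := (isHermitian_reflectorAbout Ψ₀).neg
  have hneg : -reflectorAbout Ψ₀ ∈ Matrix.unitaryGroup ι ℂ := by
    rw [mem_unitaryGroup_iff, star_neg, neg_mul_neg]
    exact mem_unitaryGroup_iff.mp (reflectorAbout_mem_unitaryGroup hΨ₀)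
  have hFJ : ∀ v, toEuclideanCLM (𝕜 := ℂ) (reflectorAbout (withAux k₀ Φ)) (J v) =
      J (toEuclideanCLM (𝕜 := ℂ) (reflectorAbout Φ) v) := fun v => by
    apply WithLp.ofLp_injective 2
    rw [ofLp_toEuclideanCLM, ofLp_auxIsometry, ofLp_auxIsometry, ofLp_toEuclideanCLM,
      reflectorAbout_mulVec, reflectorAbout_mulVec, star_withAux_dotProduct_withAux]
    ext p
    by_cases h : p.1 = k₀ <;> simp [withAux, h]
  have hcomp : ∀ v w : EuclideanSpace ℂ ι, ‖v‖ = 1 → ‖w‖ = 1 →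
      ‖⟪J w, toEuclideanCLM (𝕜 := ℂ) R (J v)⟫_ℂ -
        ⟪w, toEuclideanCLM (𝕜 := ℂ) (-reflectorAbout Ψ₀) v⟫_ℂ‖ ≤ ε := fun v w hv hw => by
    rw [inner_auxIsometry_toEuclideanCLM, ← inner_sub_right, ← _root_.sub_apply,
      ← map_sub]
    refine (norm_inner_le_norm _ _).trans ?_
    have := hB v
    rw [hv, mul_one] at this
    rwa [hw, one_mul]
  have main := norm_inner_amplification_sub_le
    (toEuclideanCLM_mem_unitary (reflectorAbout_mem_unitaryGroup
      ((star_withAux_dotProduct_withAux k₀ Φ Φ).trans hΦ)))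
    (toEuclideanCLM_mem_unitary hR)
    (toEuclideanCLM_mem_unitary (reflectorAbout_mem_unitaryGroup hΦ))
    (toEuclideanCLM_mem_unitary hneg)
    (star_toEuclideanCLM (isHermitian_reflectorAbout _)) (star_toEuclideanCLM hHerm)
    hFJ hε hcomp hΨ N hΦ'
  have exact' := norm_inner_exact_amplification hΨ hΦ'
    (F₀ := toEuclideanCLM (𝕜 := ℂ) (reflectorAbout Φ))
    (R₀ := toEuclideanCLM (𝕜 := ℂ) (-reflectorAbout Ψ₀))
    (fun v => by
      apply WithLp.ofLp_injective 2
      rw [ofLp_toEuclideanCLM, reflectorAbout_mulVec, EuclideanSpace.inner_eq_star_dotProduct,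
        dotProduct_comm]
      rfl)
    (fun v => by
      apply WithLp.ofLp_injective 2
      rw [ofLp_toEuclideanCLM, neg_mulVec, reflectorAbout_mulVec, neg_sub,
        EuclideanSpace.inner_eq_star_dotProduct, dotProduct_comm]
      rfl) N
  have hov : overlap (withAux k₀ Ψ₀) (amplified k₀ Φ R N) =
      ‖⟪J ψ, ((toEuclideanCLM (𝕜 := ℂ) (reflectorAbout (withAux k₀ Φ)) *
        toEuclideanCLM (𝕜 := ℂ) R) ^ N) (J φ)⟫_ℂ‖ := by
    rw [overlap_eq_norm_inner, ← map_mul, ← map_pow]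
    rfl
  rw [hov, overlap_eq_norm_inner, ← exact']
  refine (norm_sub_norm_le _ _).trans ?_
  rwa [norm_sub_rev]

/-- An amplitude within `N² ε` of `s` still exceeds `γ` if `6 N² ε ≤ s² - γ²`. -/
theorem le_of_abs_sub_le_of_le_div {s a γ ε n : ℝ} (hs : |s| ≤ 1) (ha : 0 ≤ a) (hε : 0 ≤ ε)
    (hn : 0 < n) (h : |s| - a ≤ n * ε) (hγ : ε ≤ (s ^ 2 - γ ^ 2) / (6 * n)) : γ ≤ a := by
  rw [le_div_iff₀ (by positivity)] at hγ
  refine le_of_sq_le_sq ?_ ha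
  have hp : 0 ≤ n * ε := by positivity
  have hs0 := abs_nonneg s
  rw [← sq_abs s] at hγ
  -- If `nε ≤ |s|`, squaring `a ≥ |s| - nε` loses at most `2nε`, as `|s| ≤ 1`. Otherwise `s² ≤ |s| <
  -- nε` would make `γ²` negative.
  by_cases hc : n * ε ≤ |s|
  · nlinarith
  · nlinarith

/-- Common to both realizations, which enter only through unitarity and the block `B`. The first
conclusion is the second with `s² = 1`. -/
theorem le_overlap_amplified {Ψ₀ Φ : ι → ℂ} (hΨ₀ : star Ψ₀ ⬝ᵥ Ψ₀ = 1)
    (hΦ : star Φ ⬝ᵥ Φ = 1) {ε : ℝ} (hε : 0 ≤ ε) {B : Matrix ι ι ℂ}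
    (hB : ∀ v, ‖toEuclideanCLM (𝕜 := ℂ) (B - -reflectorAbout Ψ₀) v‖ ≤ ε * ‖v‖) {k₀ : κ}
    {R : Matrix (κ × ι) (κ × ι) ℂ} (hR : R ∈ Matrix.unitaryGroup (κ × ι) ℂ)
    (hRB : auxBlock k₀ R = B) {N : ℕ} (hN : 1 ≤ N) (γf : ℝ) :
    (|Real.sin ((2 * N + 1) * Real.arcsin (overlap Ψ₀ Φ))| = 1 →
      ε ≤ (1 - γf ^ 2) / (6 * (N : ℝ) ^ 2) →
        γf ≤ overlap (withAux k₀ Ψ₀) (amplified k₀ Φ R N)) ∧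
    (ε ≤ (Real.sin ((2 * N + 1) * Real.arcsin (overlap Ψ₀ Φ)) ^ 2 - γf ^ 2) /
      (6 * (N : ℝ) ^ 2) → γf ≤ overlap (withAux k₀ Ψ₀) (amplified k₀ Φ R N)) := by
  subst hRB
  have general := le_of_abs_sub_le_of_le_div (γ := γf) (Real.abs_sin_le_one _) (norm_nonneg _)
    hε (show (0 : ℝ) < (N : ℝ) ^ 2 by positivity)
    (abs_sin_sub_overlap_amplified_le hΨ₀ hΦ hε hR hB N)
  refine ⟨fun hs h => general ?_, general⟩
  rwa [← sq_abs, hs, one_pow]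

end Main

theorem theorem1 {ι : Type*} [Fintype ι] [DecidableEq ι] (hdim : 1 < Fintype.card ι)
    (H : Matrix ι ι ℂ) (hH : H.IsHermitian)
    (Ψ₀ Φ : ι → ℂ)
    (hΨ₀ : star Ψ₀ ⬝ᵥ Ψ₀ = 1)
    (hground : H *ᵥ Ψ₀ = (energy hH ⟨0, Nat.zero_lt_of_lt hdim⟩ : ℂ) • Ψ₀)
    (hΦ : star Φ ⬝ᵥ Φ = 1)
    (γi γf : ℝ) (hγi : overlap Ψ₀ Φ = γi)
    (α μ δ ε : ℝ) (hα : opNorm H ≤ α)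
    (S : ℝ[X]) (hS : IsSignApprox S ε δ)
    (N : ℕ) (hN : 1 ≤ N)
    (hμ₀ : energy hH ⟨0, Nat.zero_lt_of_lt hdim⟩ < μ)
    (hμ₁ : μ < energy hH ⟨1, hdim⟩)
    (hδ : δ ≤ (⨅ k, |energy hH k - μ|) / (4 * α)) :
    -- every block encoding `R` of the approximate reflector
    (∀ (κ : Type*) [Fintype κ] [DecidableEq κ] (k₀ : κ) (R : Matrix (κ × ι) (κ × ι) ℂ),
      IsBlockEncoding k₀ 1 0 (filteredHamiltonian S H μ α) R →
        (|Real.sin ((2 * N + 1) * Real.arcsin γi)| = 1 →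
          ε ≤ (1 - γf ^ 2) / (6 * (N : ℝ) ^ 2) →
            γf ≤ overlap (withAux k₀ Ψ₀) (amplified k₀ Φ R N)) ∧
        (ε ≤ (Real.sin ((2 * N + 1) * Real.arcsin γi) ^ 2 - γf ^ 2) / (6 * (N : ℝ) ^ 2) →
            γf ≤ overlap (withAux k₀ Ψ₀) (amplified k₀ Φ R N))) ∧
    -- the quantum signal processing circuit built from a Hermitian block encoding of `H - μ I`
    (∀ (κ : Type*) [Fintype κ] [DecidableEq κ] (k₀ : κ) (U : Matrix (κ × ι) (κ × ι) ℂ),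
      U.IsHermitian →
      IsBlockEncoding k₀ (α + |μ|) 0 (H - (μ : ℂ) • (1 : Matrix ι ι ℂ)) U →
      ∀ (φ₀ : ℝ) (φs : List ℝ), PhasesImplement φ₀ φs S →
        (|Real.sin ((2 * N + 1) * Real.arcsin γi)| = 1 →
          ε ≤ (1 - γf ^ 2) / (6 * (N : ℝ) ^ 2) →
            γf ≤ overlap (withAux (0, k₀) Ψ₀)
              (amplified (0, k₀) Φ (qspCircuit k₀ φ₀ φs U) N)) ∧
        (ε ≤ (Real.sin ((2 * N + 1) * Real.arcsin γi) ^ 2 - γf ^ 2) / (6 * (N : ℝ) ^ 2) →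
            γf ≤ overlap (withAux (0, k₀) Ψ₀)
              (amplified (0, k₀) Φ (qspCircuit k₀ φ₀ φs U) N))) := by
  obtain ⟨hpos, hx, hε, hB⟩ :=
    norm_filteredHamiltonian_sub_reflector_le hdim hH hΨ₀ hground hα hS hμ₀ hμ₁ hδ
  subst hγi
  refine ⟨?_, ?_⟩
  · intro κ _ _ k₀ R hR
    exact le_overlap_amplified hΨ₀ hΦ hε hB hR.1 (by simpa using auxBlock_eq_of_isBlockEncoding hR) hN γf
  · intro κ _ _ k₀ U hU hUB φ₀ φs hφ
    -- The block of the circuit is compared with the filtered Hamiltonian on an eigenbasis of `H`,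
    -- where signal processing reduces to scalars.
    refine le_overlap_amplified hΨ₀ hΦ hε hB (qspCircuit_mem_unitaryGroup k₀ φ₀ φs hUB.1)
      (eq_of_mulVec_orthonormalBasis hH.eigenvectorBasis fun k => ?_) hN γf
    rw [filteredHamiltonian_mulVec (hH.mulVec_eigenvectorBasis k)]
    refine auxBlock_qspCircuit_mulVec hU hUB.1 (hx k) ?_ hφ
    have hblock : auxBlock k₀ U = ((α + |μ| : ℝ) : ℂ)⁻¹ • (H - (μ : ℂ) • (1 : Matrix ι ι ℂ)) := by
      rw [← auxBlock_eq_of_isBlockEncoding hUB,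
        inv_smul_smul₀ (Complex.ofReal_ne_zero.mpr hpos.ne')]
    have heig : H *ᵥ ⇑(hH.eigenvectorBasis k) =
      (hH.eigenvalues k : ℂ) • ⇑(hH.eigenvectorBasis k) := hH.mulVec_eigenvectorBasis k
    rw [hblock, smul_mulVec, sub_mulVec, smul_mulVec, one_mulVec, heig, ← sub_smul, smul_smul]
    congr 1
    push_cast
    ring
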